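/- **Setting.** Let $X\subseteq\mathbb R^d$ be compact (state space), $F\subseteq X$ open in $X$ (free space), $X_{\mathrm{goal}}\subseteq X$, $x_{\mathrm{init}}\in\mathbb R^d$, and let $U\subseteq\mathbb R^D$ (control space) be measurable of finite Lebesgue measure and such that every ball centred at a point of $U$ meets $U$ in a set of positive measure. Let $f:X\times U\to\mathbb R^d$ and $g:X\times U\to[0,\infty)$ be Lipschitz continuous in each of the two arguments, with constants that do not depend on the other argument. A *valid trajectory* of duration $T$ is a curve $\pi:[0,T]\to F$ with a control function $\Upsilon:[0,T]\to U$ such that $\dot\pi=f(\pi,\Upsilon)$, $\pi(0)=x_{\mathrm{init}}$ and $\pi(T)\in X_{\mathrm{goal}}$; its cost is $\mathrm{cost}(\pi)=\int_0^T g(\pi(t),\Upsilon(t))\,dt$. Its *clearance* is the largest $\delta>0$ such that the ball of radius $\delta$ around $\pi(t)$ is contained in $F$ for all $t\in[0,T]$ and the ball of radius $\delta$ around $\pi(T)$ is contained in $X_{\mathrm{goal}}$ (and $0$ if there is no such $\delta$). It is *robust* if its clearance is positive. The control is *piecewise constant* if it is the concatenation of finitely many (at least one) constant controls from $U$ of one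 common duration $\Delta t>0$. **Algorithm (single-tree AO-RRT)**, with parameters $T_{\mathrm{prop}}>0$ and $c_{\max}$. The tree starts with the single root $(x_{\mathrm{init}},0)\in\mathbb R^d\times\mathbb R$, and $y_{\min}$ is undefined, with cost $\infty$. Every iteration draws, independently of each other and of the previous iterations, $x_{\mathrm{rand}}$, $c_{\mathrm{rand}}$, $t_{\mathrm{rand}}$, $u_{\mathrm{rand}}$ uniformly from $X$, $[0,c_{\max}]$, $[0,T_{\mathrm{prop}}]$, $U$; takes a tree vertex $y_{\mathrm{near}}=(x,c)$ nearest to $(x_{\mathrm{rand}},c_{\mathrm{rand}})$ in the Euclidean metric of $\mathbb R^{d+1}$; and applies the constant control $u_{\mathrm{rand}}$ from $x$ for duration $t_{\mathrm{rand}}$. If the resulting trajectory $\pi_{\mathrm{new}}$ exists and lies in $F$, its endpoint $x_{\mathrm{new}}$ gives a new vertex $y_{\mathrm{new}}=(x_{\mathrm{new}},c+\mathrm{cost}(\pi_{\mathrm{new}}))$, joined to $y_{\mathrm{near}}$ by an edge that stores $\pi_{\mathrm{new}}$; if moreover $x_{\mathrm{new}}\in X_{\mathrm{goal}}$ and the cost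 coordinate of $y_{\mathrm{new}}$ is smaller than that of $y_{\min}$, then $y_{\min}$ becomes $y_{\mathrm{new}}$. After $k$ iterations the algorithm returns $\pi_k$, the concatenation of the trajectories on the tree path from the root to $y_{\min}$; if $y_{\min}$ is still undefined, there is no solution and $\mathrm{cost}(\pi_k)=\infty$. **Theorem.** Let $\varepsilon\in(0,1)$. For every robust trajectory $\pi$ with a piecewise-constant control and $0<\mathrm{cost}(\pi)\le c_{\max}$ there are $k_0\in\mathbb N$, $a>0$ and $b>0$ such that for all $k>k_0$ $$\Pr\bigl[\mathrm{cost}(\pi_k)>(1+\varepsilon)\,\mathrm{cost}(\pi)\bigr]\le a\,e^{-bk}.$$ -/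

import Mathlib

open MeasureTheory

noncomputable section

namespace AORRT

/-- `ℝⁿ` with the Euclidean norm. -/
abbrev E (n : ℕ) : Type := EuclideanSpace ℝ (Fin n)

/-- The data of a planning instance: state space `X ⊆ ℝᵈ`, free space `F`, goal region `goal`,
start state `start`, control space `U ⊆ ℝᴰ`, dynamics `f` and cost derivative `g` (only their
values on `X × U` are ever constrained), together with the two numerical parameters of the
planner, the maximal propagation duration `tProp` and the maximal sampled cost `cMax`. -/
structure Problem (d D : ℕ) where
  X : Set (E d)
  F : Set (E d)
  goal : Set (E d)
  start : E d
  U : Set (E D)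
  f : E d → E D → E d
  g : E d → E D → ℝ
  tProp : ℝ
  cMax : ℝ

/-- `h` is Lipschitz continuous on `X × U` in each of its two arguments, uniformly in the other. -/
def LipschitzInBoth {d D : ℕ} {V : Type*} [NormedAddCommGroup V]
    (X : Set (E d)) (U : Set (E D)) (h : E d → E D → V) : Prop :=
  ∃ Ku > (0 : ℝ), ∃ Kx > (0 : ℝ), ∀ x₀ ∈ X, ∀ x₁ ∈ X, ∀ u₀ ∈ U, ∀ u₁ ∈ U,
    ‖h x₀ u₀ - h x₀ u₁‖ ≤ Ku * ‖u₀ - u₁‖ ∧ ‖h x₀ u₀ - h x₁ u₀‖ ≤ Kx * ‖x₀ - x₁‖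

/-- A state curve on `[0, duration]` together with its control function. Values of the two
functions outside `[0, duration]` are irrelevant. -/
structure Traj (d D : ℕ) where
  duration : ℝ
  state : ℝ → E d
  control : ℝ → E D

namespace Traj

variable {d D : ℕ}

/-- `cost(π) = ∫₀ᵀ g(π(t), Υ(t)) dt`. -/
def cost (g : E d → E D → ℝ) (π : Traj d D) : ℝ :=
  ∫ t in (0 : ℝ)..π.duration, g (π.state t) (π.control t)

/-- The state curve solves `ẋ = f(x, Υ)` on `[0, T]` (in integrated form, the usual notion of
solution for a control function that may jump). -/
def Solves (f : E d → E D → E d) (π : Traj d D) : Prop :=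
  0 ≤ π.duration ∧ ContinuousOn π.state (Set.Icc 0 π.duration) ∧
  IntervalIntegrable (fun s => f (π.state s) (π.control s)) volume 0 π.duration ∧
  ∀ t ∈ Set.Icc 0 π.duration,
    π.state t = π.state 0 + ∫ s in (0 : ℝ)..t, f (π.state s) (π.control s)

/-- The whole state curve lies in the free space `F`. -/
def CollisionFree (F : Set (E d)) (π : Traj d D) : Prop :=
  ∀ t ∈ Set.Icc 0 π.duration, π.state t ∈ F

/-- The control function is a concatenation of `n ≥ 1` constant controls from `U`, each of the
same duration `Δ > 0`. -/
def PiecewiseConstant (U : Set (E D)) (π : Traj d D) : Prop :=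
  ∃ Δ > (0 : ℝ), ∃ n : ℕ, 0 < n ∧ π.duration = n * Δ ∧
    ∃ u : Fin n → E D, (∀ i, u i ∈ U) ∧
      ∀ i : Fin n, ∀ t ∈ Set.Ico ((i : ℝ) * Δ) (((i : ℝ) + 1) * Δ), π.control t = u i

/-- `π` is a valid trajectory of the instance: its control takes values in `U`, it obeys the
dynamics, stays in the free space, and leads from the start state to the goal region. -/
def Valid (Q : Problem d D) (π : Traj d D) : Prop :=
  (∀ t ∈ Set.Icc 0 π.duration, π.control t ∈ Q.U) ∧ π.Solves Q.f ∧ π.CollisionFree Q.F ∧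
    π.state 0 = Q.start ∧ π.state π.duration ∈ Q.goal

/-- The largest radius `δ > 0` such that all `δ`-balls around `π` lie in the free space and the
`δ`-ball around its endpoint lies in the goal region; `0` if there is none. -/
def clearance (Q : Problem d D) (π : Traj d D) : ENNReal :=
  ⨆ (δ : ℝ) (_ : 0 < δ ∧ (⋃ t ∈ Set.Icc 0 π.duration, Metric.ball (π.state t) δ) ⊆ Q.F ∧
    Metric.ball (π.state π.duration) δ ⊆ Q.goal), ENNReal.ofReal δ

/-- A robust trajectory: valid, with positive clearance. -/
def Robust (Q : Problem d D) (π : Traj d D) : Prop :=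
  π.Valid Q ∧ 0 < π.clearance Q

/-- The trajectory of duration `0` at `x`. -/
def stay (x : E d) : Traj d D where
  duration := 0
  state := fun _ => x
  control := fun _ => 0

/-- Concatenation: first `π`, then `ρ`. -/
def concat (π ρ : Traj d D) : Traj d D where
  duration := π.duration + ρ.duration
  state := fun t => if t < π.duration then π.state t else ρ.state (t - π.duration)
  control := fun t => if t < π.duration then π.control t else ρ.control (t - π.duration)

/-- `π` is the result of applying the constant control `u` from state `x` for duration `t`. -/
def IsPropagation (f : E d → E D → E d) (x : E d) (u : E D) (t : ℝ) (π : Traj d D) : Prop :=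
  π.duration = t ∧ π.state 0 = x ∧ (∀ s, π.control s = u) ∧ π.Solves f

end Traj

/-- The Euclidean distance of the state-cost space `ℝᵈ × ℝ = ℝᵈ⁺¹`. -/
def augDist {d : ℕ} (y z : E d × ℝ) : ℝ :=
  Real.sqrt (‖y.1 - z.1‖ ^ 2 + |y.2 - z.2| ^ 2)

/-- A vertex of the search tree: a point `(x, c)` of the state-cost space and, unless it is the
root, its parent vertex and the trajectory stored on the edge from the parent. -/
inductive Vertex (d D : ℕ) : Type
  | root (y : E d × ℝ) : Vertex d D
  | child (parent : Vertex d D) (y : E d × ℝ) (edge : Traj d D) : Vertex d D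

namespace Vertex

variable {d D : ℕ}

/-- The point `(x, c)` of a vertex. -/
def point : Vertex d D → E d × ℝ
  | root y => y
  | child _ y _ => y

/-- The concatenation of the edge trajectories on the tree path from the root to the vertex. -/
def tracePath : Vertex d D → Traj d D
  | root y => Traj.stay y.1
  | child p _ e => p.tracePath.concat e

end Vertex

/-- The memory of the planner: the vertices of the tree, and the cheapest vertex found so far in
the goal region (`none` as long as there is none). -/
structure Memory (d D : ℕ) where
  tree : List (Vertex d D)
  best : Option (Vertex d D)

/-- The cost value of the current best vertex, `∞` if there is none. -/
def Memory.bestCost {d D : ℕ} (M : Memory d D) : EReal :=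
  M.best.elim ⊤ fun v => ((v.point.2 : ℝ) : EReal)

/-- What is drawn at random in one iteration: `(x_rand, c_rand, t_rand, u_rand)`. -/
abbrev Sample (d D : ℕ) : Type := E d × ℝ × ℝ × E D

namespace Problem

variable {d D : ℕ} (Q : Problem d D)

/-- Before the first iteration, the tree consists of the root `(start, 0)`. -/
def initMemory : Memory d D where
  tree := [Vertex.root (Q.start, 0)]
  best := none

open Classical in
/-- One iteration. The vertex nearest to `(x_rand, c_rand)` is extended by applying `u_rand` for
duration `t_rand`. If this gives a collision-free trajectory, its endpoint becomes a new vertex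
whose cost is that of the near vertex plus the cost of the new trajectory; it replaces the best
vertex if it lies in the goal region and is strictly cheaper. Otherwise (in particular when the
motion leaves the state space, where the dynamics are not defined) nothing is added. -/
def step (M : Memory d D) (s : Sample d D) : Memory d D :=
  match M.tree.argmin (fun v => augDist (s.1, s.2.1) v.point) with
  | none => M
  | some near =>
    if h : ∃ π : Traj d D, π.IsPropagation Q.f near.point.1 s.2.2.2 s.2.2.1 ∧
        π.CollisionFree Q.F then
      let edge : Traj d D := h.choose
      let new : Vertex d D :=
        Vertex.child near (edge.state edge.duration, near.point.2 + edge.cost Q.g) edge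
      { tree := new :: M.tree
        best := if new.point.1 ∈ Q.goal ∧ ((new.point.2 : ℝ) : EReal) < M.bestCost
          then some new else M.best }
    else M

/-- The memory after `k` iterations that use the samples `s 0, …, s (k - 1)`. -/
def run (s : ℕ → Sample d D) : ℕ → Memory d D
  | 0 => Q.initMemory
  | k + 1 => Q.step (run s k) (s k)

/-- The trajectory returned after `k` iterations, if a solution has been found. -/
def solution (s : ℕ → Sample d D) (k : ℕ) : Option (Traj d D) :=
  (Q.run s k).best.map Vertex.tracePath

/-- The cost of the returned trajectory, `∞` if no solution has been found. -/
def solutionCost (s : ℕ → Sample d D) (k : ℕ) : EReal :=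
  (Q.solution s k).elim ⊤ fun π => ((π.cost Q.g : ℝ) : EReal)

/-- The law of one sample: state, cost, duration and control are independent and uniformly
distributed on `X`, `[0, cMax]`, `[0, tProp]` and `U`. -/
def sampleLaw : Measure (Sample d D) :=
  (ProbabilityTheory.cond volume Q.X).prod
    ((ProbabilityTheory.cond volume (Set.Icc 0 Q.cMax)).prod
      ((ProbabilityTheory.cond volume (Set.Icc 0 Q.tProp)).prod
        (ProbabilityTheory.cond volume Q.U)))

end Problem

end AORRT

end

/-! The proof separates the planner from the randomness. The deterministic part provides a finite
list of sample sets of positive probability, depending only on the instance, `π` and `ε`, such that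
every sample sequence with controls in `U` that hits these sets in order makes the planner return a
trajectory of cost at most `(1 + ε) cost(π)`. Independent samples fail to do so before time `k` with
exponentially small probability (`exists_measureReal_not_hitsInOrder_le`), and controls outside `U`
have probability zero.

The list is built along the curve `t ↦ (π(t), cost up to t)` in state-cost space, cut into short
pieces of constant control. If some tree vertex and the sampled point both lie within `r` of a point
`y` of the curve, then the nearest vertex lies within `5 * r` of `y`, however the tree has grown
elsewhere (`CloserThan.of_augDist_le`). Applying to it nearly the control and duration of the next
piece of `π` gives a vertex near the next point of the curve, because short motions and their costs
depend on the data in a Lipschitz way; the clearance excludes collisions. Thus any accuracy at the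
next point is ensured by a suitable accuracy at `y` and one more sample set (`Reachable.propagate`),
and induction along `π` reaches its end.

There, the clearance puts the vertex into the goal region, and its cost coordinate is close to
`cost(π)`. The best vertex is at least as cheap (`bestIsMinimal_run`), and its cost coordinate is
the true cost of the returned path (`solutionCost_eq_bestCost`). -/

namespace AORRT

/-! ### Hitting an ordered list of sets with independent samples -/

/-- Before time `k`, the sequence `s` visits the sets of the list, the last set of the list
first and its head last. -/
def HitsInOrder {α : Type*} (s : ℕ → α) : List (Set α) → ℕ → Prop
  | [], _ => True
  | G :: L, k => ∃ j < k, s j ∈ G ∧ HitsInOrder s L j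

theorem HitsInOrder.mono {α : Type*} {s : ℕ → α} {L : List (Set α)} {j k : ℕ}
    (h : HitsInOrder s L j) (hjk : j ≤ k) : HitsInOrder s L k := by
  cases L with
  | nil => trivial
  | cons G L =>
    obtain ⟨i, hi, h⟩ := h
    exact ⟨i, hi.trans_le hjk, h⟩

section

variable {α : Type*} [MeasurableSpace α] {μ : Measure α}

/-- By independence the probability is `(1 - p) ^ (k - m)` with `p = μ.real G`, and `1 - p ≤ exp
(-p)`. -/
theorem measureReal_forall_notMem_le {Ω : Type*} [MeasurableSpace Ω] {P : Measure Ω}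
    [IsProbabilityMeasure P] {ξ : ℕ → Ω → α} (hξ : ∀ i, Measurable (ξ i))
    (hlaw : ∀ i, P.map (ξ i) = μ) (hind : ProbabilityTheory.iIndepFun ξ P)
    {G : Set α} (hG : MeasurableSet G) (m k : ℕ) :
    P.real {ω | ∀ j ∈ Finset.Ico m k, ξ j ω ∉ G} ≤ Real.exp (-μ.real G * ((k - m : ℕ) : ℝ)) := by
  have hset : {ω | ∀ j ∈ Finset.Ico m k, ξ j ω ∉ G}
      = ⋂ j ∈ Finset.Ico m k, ξ j ⁻¹' Gᶜ := by
    ext ω; simp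
  have hμ : IsProbabilityMeasure μ := by
    rw [← hlaw 0]; exact Measure.isProbabilityMeasure_map (hξ 0).aemeasurable
  have hone : ∀ j, P (ξ j ⁻¹' Gᶜ) = μ Gᶜ := fun j => by
    rw [← hlaw j, Measure.map_apply (hξ j) hG.compl]
  rw [hset, Measure.real, hind.measure_inter_preimage_eq_mul _ (fun _ _ => hG.compl)]
  simp only [hone, Finset.prod_const, Nat.card_Ico, ENNReal.toReal_pow]
  change μ.real Gᶜ ^ _ ≤ _
  rw [probReal_compl_eq_one_sub hG, mul_comm, Real.exp_nat_mul]
  refine pow_le_pow_left₀ ?_ ?_ _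
  · linarith [measureReal_le_one (μ := μ) (s := G)]
  · linarith [Real.add_one_le_exp (-μ.real G)]

/-- A sequence of independent samples misses a fixed ordered list of sets of positive measure
with exponentially small probability. -/
theorem exists_measureReal_not_hitsInOrder_le [IsProbabilityMeasure μ] (L : List (Set α))
    (hL : ∀ G ∈ L, MeasurableSet G ∧ 0 < μ G) :
    ∃ a > (0 : ℝ), ∃ b > (0 : ℝ),
      ∀ (Ω : Type*) [MeasurableSpace Ω] (P : Measure Ω) [IsProbabilityMeasure P]
        (ξ : ℕ → Ω → α), (∀ i, Measurable (ξ i)) → (∀ i, P.map (ξ i) = μ) →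
        ProbabilityTheory.iIndepFun ξ P → ∀ k : ℕ,
          P.real {ω | ¬ HitsInOrder (fun i => ξ i ω) L k} ≤ a * Real.exp (-b * k) := by
  induction L with
  | nil =>
    refine ⟨1, one_pos, 1, one_pos, fun Ω _ P _ ξ _ _ _ k => ?_⟩
    simp only [HitsInOrder, not_true_eq_false, Set.ofPred_false, measureReal_empty]
    positivity
  | cons G L ih =>
    obtain ⟨a, ha, b, hb, ih⟩ := ih fun G' hG' => hL G' (List.mem_cons_of_mem _ hG')
    obtain ⟨hG, hpos⟩ := hL G List.mem_cons_self
    have hp : 0 < μ.real G := ENNReal.toReal_pos hpos.ne' (measure_ne_top _ _)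
    set p := μ.real G with hpdef
    -- The tail `L`, which is visited first, gets the first `k / 2` samples and `G` gets the others.
    -- Splitting the time halves the rate; the factor `exp (b / 2)` pays for rounding `k / 2` down.
    refine ⟨a * Real.exp (b / 2) + 1, by positivity, min b p / 2, by positivity,
      fun Ω _ P _ ξ hξ hlaw hind k => ?_⟩
    have hsub : {ω | ¬ HitsInOrder (fun i => ξ i ω) (G :: L) k} ⊆
        {ω | ¬ HitsInOrder (fun i => ξ i ω) L (k / 2)} ∪
          {ω | ∀ j ∈ Finset.Ico (k / 2) k, ξ j ω ∉ G} := by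
      intro ω hω
      by_contra hcon
      simp only [Set.mem_union, Set.mem_ofPred_eq, not_or, not_not, not_forall] at hcon
      obtain ⟨h1, j, hj, hjG⟩ := hcon
      rw [Finset.mem_Ico] at hj
      exact hω ⟨j, hj.2, hjG, h1.mono hj.1⟩
    have h2 : (k : ℝ) ≤ 2 * ((k / 2 : ℕ) : ℝ) + 1 := by
      exact_mod_cast (by omega : k ≤ 2 * (k / 2) + 1)
    have h3 : (k : ℝ) ≤ 2 * ((k - k / 2 : ℕ) : ℝ) := by
      exact_mod_cast (by omega : k ≤ 2 * (k - k / 2))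
    have hk : (0 : ℝ) ≤ k := Nat.cast_nonneg k
    have e1 : Real.exp (-b * ((k / 2 : ℕ) : ℝ)) ≤
        Real.exp (b / 2) * Real.exp (-(min b p / 2) * k) := by
      rw [← Real.exp_add]
      refine Real.exp_le_exp.mpr ?_
      nlinarith [mul_le_mul_of_nonneg_left h2 hb.le,
        mul_le_mul_of_nonneg_right (min_le_left b p) hk]
    have e2 : Real.exp (-p * ((k - k / 2 : ℕ) : ℝ)) ≤ Real.exp (-(min b p / 2) * k) := by
      refine Real.exp_le_exp.mpr ?_
      nlinarith [mul_le_mul_of_nonneg_left h3 hp.le,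
        mul_le_mul_of_nonneg_right (min_le_right b p) hk]
    calc P.real {ω | ¬ HitsInOrder (fun i => ξ i ω) (G :: L) k}
        ≤ P.real _ := measureReal_mono hsub
      _ ≤ _ := measureReal_union_le _ _
      _ ≤ a * Real.exp (-b * ((k / 2 : ℕ) : ℝ)) + Real.exp (-p * ((k - k / 2 : ℕ) : ℝ)) :=
          add_le_add (ih Ω P ξ hξ hlaw hind _) (measureReal_forall_notMem_le hξ hlaw hind hG _ _)
      _ ≤ a * (Real.exp (b / 2) * Real.exp (-(min b p / 2) * k))
            + Real.exp (-(min b p / 2) * k) := by gcongr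
      _ = _ := by ring

end

/-! ### Motions under a constant control and their stability -/

section

variable {d D : ℕ} {f : E d → E D → E d}

/-- Picard-Lindelöf: a constant control can be applied as long as the speed bound does not let the
motion leave a collision-free ball. -/
theorem exists_isPropagation {F : Set (E d)} {x : E d} {u : E D} {σ a M K : ℝ}
    (hσ : 0 ≤ σ) (ha : 0 ≤ a) (hM : 0 ≤ M) (hK : 0 ≤ K)
    (hF : Metric.closedBall x a ⊆ F)
    (hb : ∀ y ∈ Metric.closedBall x a, ‖f y u‖ ≤ M)
    (hlip : ∀ y ∈ Metric.closedBall x a, ∀ z ∈ Metric.closedBall x a,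
      ‖f y u - f z u‖ ≤ K * ‖y - z‖)
    (hMσ : M * σ ≤ a) :
    ∃ ρ : Traj d D, ρ.IsPropagation f x u σ ∧ ρ.CollisionFree F := by
  have h0σ : (0 : ℝ) ∈ Set.Icc 0 σ := ⟨le_rfl, hσ⟩
  lift a to NNReal using ha
  lift M to NNReal using hM
  lift K to NNReal using hK
  have hPL : IsPicardLindelof (fun _ : ℝ => fun y => f y u) (tmin := 0) (tmax := σ)
      ⟨0, h0σ⟩ x a 0 M K := by
    refine IsPicardLindelof.of_time_independent hb ?_ ?_
    · refine LipschitzOnWith.of_dist_le_mul fun y hy z hz => ?_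
      rw [dist_eq_norm, dist_eq_norm]
      exact hlip y hy z hz
    · change M * max (σ - 0) (0 - 0) ≤ a - 0
      rw [sub_zero, sub_zero, sub_zero, max_eq_left hσ]
      exact hMσ
  have hx0 : x ∈ Metric.closedBall x ((0 : NNReal) : ℝ) := by simp
  -- The Picard fixed point itself is used: its equation is the integrated form required by
  -- `Solves`, and its values stay in the ball.
  obtain ⟨α, hα⟩ := ODE.FunSpace.exists_isFixedPt_next hPL hx0
  have hα' := (ODE.FunSpace.isFixedPt_next_iff hPL hx0).mp hα
  have hmem : ∀ t, α.compProj t ∈ Metric.closedBall x a := fun t => α.mem_closedBall hPL.mul_max_le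
  have hcont : Continuous α.compProj := α.continuous_compProj
  have h0 : α.compProj 0 = x := by
    rw [ODE.FunSpace.compProj_apply, Set.projIcc_of_mem hσ h0σ, hα' _]
    simp [ODE.picard_apply]
  refine ⟨⟨σ, α.compProj, fun _ => u⟩, ⟨rfl, h0, fun _ => rfl, hσ, hcont.continuousOn, ?_, ?_⟩,
    fun t _ => hF (hmem t)⟩
  · exact α.intervalIntegrable_comp_compProj hPL ⟨σ, hσ, le_rfl⟩
  · intro t (ht : t ∈ Set.Icc 0 σ)
    change α.compProj t = α.compProj 0 + _
    rw [h0]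
    conv_lhs => rw [ODE.FunSpace.compProj_apply, Set.projIcc_of_mem hσ ht, hα' _]
    rw [ODE.picard_apply]

theorem Traj.IsPropagation.eq_integral {x : E d} {u : E D} {σ : ℝ} {ρ : Traj d D}
    (h : ρ.IsPropagation f x u σ) {t : ℝ} (ht : t ∈ Set.Icc 0 σ) :
    ρ.state t = x + ∫ s in (0 : ℝ)..t, f (ρ.state s) u := by
  obtain ⟨rfl, rfl, hu, -, -, -, h⟩ := h
  simpa only [hu] using h t ht

theorem Traj.IsPropagation.intervalIntegrable {x : E d} {u : E D} {σ : ℝ} {ρ : Traj d D}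
    (h : ρ.IsPropagation f x u σ) {t : ℝ} (ht : t ∈ Set.Icc 0 σ) :
    IntervalIntegrable (fun s => f (ρ.state s) u) volume 0 t := by
  obtain ⟨rfl, rfl, hu, -, -, h, -⟩ := h
  simp only [hu] at h
  exact h.mono_set (Set.uIcc_subset_uIcc_left (by rwa [Set.uIcc_of_le (ht.1.trans ht.2)]))

theorem Traj.IsPropagation.continuousOn {x : E d} {u : E D} {σ : ℝ} {ρ : Traj d D}
    (h : ρ.IsPropagation f x u σ) : ContinuousOn ρ.state (Set.Icc 0 σ) := by
  obtain ⟨rfl, -, -, -, h, -⟩ := h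
  exact h

theorem Traj.IsPropagation.cost_eq {x : E d} {u : E D} {σ : ℝ} {ρ : Traj d D}
    (h : ρ.IsPropagation f x u σ) (g : E d → E D → ℝ) :
    ρ.cost g = ∫ s in (0 : ℝ)..σ, g (ρ.state s) u := by
  obtain ⟨rfl, -, hu, -⟩ := h
  simp only [Traj.cost, hu]

/-- Two functions on `X × U` are Lipschitz in both arguments with the constant `K`. -/
def LipschitzInBothWith {V : Type*} [NormedAddCommGroup V]
    (K : ℝ) (X : Set (E d)) (U : Set (E D)) (h : E d → E D → V) : Prop :=
  ∀ x ∈ X, ∀ y ∈ X, ∀ u ∈ U, ∀ v ∈ U, ‖h x u - h y v‖ ≤ K * ‖x - y‖ + K * ‖u - v‖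

theorem LipschitzInBoth.exists_with {V : Type*} [NormedAddCommGroup V]
    {X : Set (E d)} {U : Set (E D)} {h : E d → E D → V} (hh : LipschitzInBoth X U h) :
    ∃ K > (0 : ℝ), ∀ K' ≥ K, LipschitzInBothWith K' X U h := by
  obtain ⟨Ku, hKu, Kx, hKx, hh⟩ := hh
  refine ⟨max Ku Kx, by positivity, fun K' hK' x hx y hy u hu v hv => ?_⟩
  have h1 := (hh x hx y hy u hu v hv).2
  have h2 := (hh y hy y hy u hu v hv).1
  have h3 : Kx * ‖x - y‖ ≤ K' * ‖x - y‖ := by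
    gcongr; exact (le_max_right _ _).trans hK'
  have h4 : Ku * ‖u - v‖ ≤ K' * ‖u - v‖ := by
    gcongr; exact (le_max_left _ _).trans hK'
  calc ‖h x u - h y v‖ = ‖(h x u - h y u) + (h y u - h y v)‖ := by congr 1; abel
    _ ≤ _ := norm_add_le _ _
    _ ≤ _ := by linarith

theorem LipschitzInBothWith.continuousOn {V : Type*} [NormedAddCommGroup V] {K : ℝ}
    {X : Set (E d)} {U : Set (E D)} {h : E d → E D → V} (hh : LipschitzInBothWith K X U h)
    (hK : 0 ≤ K) {u : E D} (hu : u ∈ U) : ContinuousOn (fun x => h x u) X := by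
  refine (LipschitzOnWith.of_dist_le_mul (K := ⟨K, hK⟩) fun y hy z hz => ?_).continuousOn
  rw [dist_eq_norm, dist_eq_norm]
  refine (hh y hy z hz u hu u hu).trans_eq ?_
  rw [sub_self, norm_zero, mul_zero, add_zero]
  rfl

theorem LipschitzInBothWith.intervalIntegrable {V : Type*} [NormedAddCommGroup V] {K : ℝ}
    {X : Set (E d)} {U : Set (E D)} {h : E d → E D → V} (hh : LipschitzInBothWith K X U h)
    (hK : 0 ≤ K) {u : E D} (hu : u ∈ U) {σ : ℝ} (hσ : 0 ≤ σ) {p : ℝ → E d}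
    (hp : ContinuousOn p (Set.Icc 0 σ)) (hpX : ∀ t ∈ Set.Icc 0 σ, p t ∈ X) :
    IntervalIntegrable (fun t => h (p t) u) volume 0 σ := by
  refine ContinuousOn.intervalIntegrable ?_
  rw [Set.uIcc_of_le hσ]
  exact (hh.continuousOn hK hu).comp hp hpX

section Compare

variable {X : Set (E d)} {U : Set (E D)} {K M σ τ : ℝ} {x y : E d} {u v : E D} {ρ q : Traj d D}

/-- Motions of short duration depend in a Lipschitz way on the initial state and the control. -/
theorem Traj.IsPropagation.norm_state_sub_le
    (hf : LipschitzInBothWith K X U f) (hK : 0 ≤ K) (hu : u ∈ U) (hv : v ∈ U)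
    (hρ : ρ.IsPropagation f x u σ) (hρX : ∀ t ∈ Set.Icc 0 σ, ρ.state t ∈ X)
    (hq : q.IsPropagation f y v τ) (hqX : ∀ t ∈ Set.Icc 0 τ, q.state t ∈ X)
    (hστ : σ ≤ τ) (hKτ : K * τ ≤ 1 / 2) {t : ℝ} (ht : t ∈ Set.Icc 0 σ) :
    ‖ρ.state t - q.state t‖ ≤ 2 * ‖x - y‖ + ‖u - v‖ := by
  have hσ : 0 ≤ σ := ht.1.trans ht.2
  have hsub : Set.Icc 0 σ ⊆ Set.Icc 0 τ := Set.Icc_subset_Icc_right hστ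
  -- Absorption instead of Grönwall: the maximal deviation `B` satisfies `B ≤ ‖x - y‖ + (B + ‖u -
  -- v‖) / 2`, because `K * τ ≤ 1 / 2`.
  obtain ⟨s, hs, hmax⟩ := isCompact_Icc.exists_isMaxOn ⟨0, le_rfl, hσ⟩
    ((hρ.continuousOn.sub (hq.continuousOn.mono hsub)).norm)
  refine (hmax ht).trans ?_
  change ‖ρ.state s - q.state s‖ ≤ _
  set B := ‖ρ.state s - q.state s‖ with hB
  have hdiff : ρ.state s - q.state s
      = (x - y) + ∫ r in (0 : ℝ)..s, (f (ρ.state r) u - f (q.state r) v) := by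
    rw [intervalIntegral.integral_sub (hρ.intervalIntegrable hs) (hq.intervalIntegrable (hsub hs)),
      hρ.eq_integral hs, hq.eq_integral (hsub hs)]
    abel
  have hint : ‖∫ r in (0 : ℝ)..s, (f (ρ.state r) u - f (q.state r) v)‖
      ≤ (K * B + K * ‖u - v‖) * |s - 0| := by
    refine intervalIntegral.norm_integral_le_of_norm_le_const fun r hr => ?_
    rw [Set.uIoc_of_le hs.1] at hr
    have hr' : r ∈ Set.Icc 0 σ := ⟨hr.1.le, hr.2.trans hs.2⟩
    refine (hf _ (hρX r hr') _ (hqX r (hsub hr')) u hu v hv).trans ?_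
    have : ‖ρ.state r - q.state r‖ ≤ B := hmax hr'
    gcongr
  rw [sub_zero, abs_of_nonneg hs.1] at hint
  have hB' : B ≤ ‖x - y‖ + (K * B + K * ‖u - v‖) * s := by
    calc B = _ := by rw [hB, hdiff]
      _ ≤ _ := norm_add_le _ _
      _ ≤ _ := by linarith
  have hB0 : 0 ≤ B := norm_nonneg _
  have hs' : (K * B + K * ‖u - v‖) * s ≤ 1 / 2 * (B + ‖u - v‖) := by
    have : K * s ≤ 1 / 2 := (mul_le_mul_of_nonneg_left (hs.2.trans hστ) hK).trans hKτ
    calc (K * B + K * ‖u - v‖) * s = K * s * (B + ‖u - v‖) := by ring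
      _ ≤ _ := by gcongr
  linarith

/-- The two motions are compared at time `σ`; during the remaining time `τ - σ` the motion `q` has
speed at most `M`. -/
theorem Traj.IsPropagation.norm_endpoint_sub_le
    (hf : LipschitzInBothWith K X U f) (hK : 0 ≤ K) (hu : u ∈ U) (hv : v ∈ U)
    (hρ : ρ.IsPropagation f x u σ) (hρX : ∀ t ∈ Set.Icc 0 σ, ρ.state t ∈ X)
    (hq : q.IsPropagation f y v τ) (hqX : ∀ t ∈ Set.Icc 0 τ, q.state t ∈ X)
    (hσ : 0 ≤ σ) (hστ : σ ≤ τ) (hKτ : K * τ ≤ 1 / 2) (hM : ∀ z ∈ X, ‖f z v‖ ≤ M) :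
    ‖ρ.state σ - q.state τ‖ ≤ 2 * ‖x - y‖ + ‖u - v‖ + M * (τ - σ) := by
  have h1 := hρ.norm_state_sub_le hf hK hu hv hρX hq hqX hστ hKτ ⟨hσ, le_rfl⟩
  have hτ : 0 ≤ τ := hσ.trans hστ
  have h2 : ‖q.state τ - q.state σ‖ ≤ M * |τ - σ| := by
    rw [hq.eq_integral ⟨hτ, le_rfl⟩, hq.eq_integral ⟨hσ, hστ⟩, add_sub_add_left_eq_sub,
      intervalIntegral.integral_interval_sub_left (hq.intervalIntegrable ⟨hτ, le_rfl⟩)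
        (hq.intervalIntegrable ⟨hσ, hστ⟩)]
    refine intervalIntegral.norm_integral_le_of_norm_le_const fun r hr => hM _ (hqX r ?_)
    rw [Set.uIoc_of_le hστ] at hr
    exact ⟨hσ.trans hr.1.le, hr.2⟩
  rw [abs_of_nonneg (by linarith)] at h2
  calc ‖ρ.state σ - q.state τ‖ = ‖(ρ.state σ - q.state σ) - (q.state τ - q.state σ)‖ := by
        congr 1; abel
    _ ≤ _ := _root_.norm_sub_le _ _
    _ ≤ _ := by linarith

/-- Up to time `σ` the integrands differ by at most `2 * K * (‖x - y‖ + ‖u - v‖)`, and `K * σ ≤ 1 /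
2`; the rest of `q` costs at most `M * (τ - σ)`. -/
theorem Traj.IsPropagation.abs_cost_sub_le {g : E d → E D → ℝ}
    (hf : LipschitzInBothWith K X U f) (hg : LipschitzInBothWith K X U g)
    (hK : 0 ≤ K) (hu : u ∈ U) (hv : v ∈ U)
    (hρ : ρ.IsPropagation f x u σ) (hρX : ∀ t ∈ Set.Icc 0 σ, ρ.state t ∈ X)
    (hq : q.IsPropagation f y v τ) (hqX : ∀ t ∈ Set.Icc 0 τ, q.state t ∈ X)
    (hσ : 0 ≤ σ) (hστ : σ ≤ τ) (hKτ : K * τ ≤ 1 / 2) (hM : ∀ z ∈ X, ‖g z v‖ ≤ M) :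
    |ρ.cost g - q.cost g| ≤ ‖x - y‖ + ‖u - v‖ + M * (τ - σ) := by
  have hτ : 0 ≤ τ := hσ.trans hστ
  have hsub : Set.Icc 0 σ ⊆ Set.Icc 0 τ := Set.Icc_subset_Icc_right hστ
  have iρ := hg.intervalIntegrable hK hu hσ hρ.continuousOn hρX
  have iq := hg.intervalIntegrable hK hv hτ hq.continuousOn hqX
  have iq' := hg.intervalIntegrable hK hv hσ (hq.continuousOn.mono hsub)
    fun t ht => hqX t (hsub ht)
  rw [hρ.cost_eq, hq.cost_eq]
  have h1 : ‖(∫ s in (0 : ℝ)..σ, g (ρ.state s) u) - ∫ s in (0 : ℝ)..σ, g (q.state s) v‖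
      ≤ (K * (2 * ‖x - y‖ + ‖u - v‖) + K * ‖u - v‖) * |σ - 0| := by
    rw [← intervalIntegral.integral_sub iρ iq']
    refine intervalIntegral.norm_integral_le_of_norm_le_const fun r hr => ?_
    rw [Set.uIoc_of_le hσ] at hr
    have hr' : r ∈ Set.Icc 0 σ := ⟨hr.1.le, hr.2⟩
    refine (hg _ (hρX r hr') _ (hqX r (hsub hr')) u hu v hv).trans ?_
    have := hρ.norm_state_sub_le hf hK hu hv hρX hq hqX hστ hKτ hr'
    gcongr
  have h2 : ‖(∫ s in (0 : ℝ)..τ, g (q.state s) v) - ∫ s in (0 : ℝ)..σ, g (q.state s) v‖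
      ≤ M * |τ - σ| := by
    rw [intervalIntegral.integral_interval_sub_left iq iq']
    refine intervalIntegral.norm_integral_le_of_norm_le_const fun r hr => hM _ (hqX r ?_)
    rw [Set.uIoc_of_le hστ] at hr
    exact ⟨hσ.trans hr.1.le, hr.2⟩
  rw [Real.norm_eq_abs] at h1 h2
  rw [abs_of_nonneg (by linarith : 0 ≤ τ - σ)] at h2
  rw [sub_zero, abs_of_nonneg hσ] at h1
  have h3 : (K * (2 * ‖x - y‖ + ‖u - v‖) + K * ‖u - v‖) * σ ≤ ‖x - y‖ + ‖u - v‖ := by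
    have : K * σ ≤ 1 / 2 := (mul_le_mul_of_nonneg_left hστ hK).trans hKτ
    have h0 : 0 ≤ 2 * ‖x - y‖ + 2 * ‖u - v‖ := by positivity
    nlinarith [mul_le_mul_of_nonneg_right this h0]
  rw [abs_le] at h1 h2 ⊢
  constructor <;> linarith [h1.1, h1.2, h2.1, h2.2]

end Compare

/-- A piece of a trajectory on which the control is constant is a propagation. -/
theorem Traj.Solves.isPropagation {π : Traj d D} (hπ : π.Solves f) {t τ : ℝ} {u : E D}
    (ht : 0 ≤ t) (hτ : 0 ≤ τ) (htτ : t + τ ≤ π.duration)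
    (hu : ∀ s ∈ Set.Ico t (t + τ), π.control s = u) :
    (⟨τ, fun s => π.state (t + s), fun _ => u⟩ : Traj d D).IsPropagation f (π.state t) u τ := by
  obtain ⟨hd, hc, hi, he⟩ := hπ
  have hmaps : Set.MapsTo (fun s => t + s) (Set.Icc 0 τ) (Set.Icc 0 π.duration) :=
    fun s hs => ⟨add_nonneg ht hs.1, (by linarith [hs.2])⟩
  have hi' : ∀ a ∈ Set.Icc 0 π.duration,
      IntervalIntegrable (fun s => f (π.state s) (π.control s)) volume 0 a := fun a ha =>
    hi.mono_set (Set.uIcc_subset_uIcc_left (by rwa [Set.uIcc_of_le hd]))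
  -- At time `t + τ` the control may already have jumped, so the integrands agree only off that
  -- instant.
  have hcongr : ∀ s ∈ Set.Icc 0 τ, ∀ᵐ r ∂volume, r ∈ Set.uIoc 0 s →
      f (π.state (t + r)) (π.control (t + r)) = f (π.state (t + r)) u := by
    intro s hs
    have : ∀ᵐ r ∂(volume : Measure ℝ), r ≠ τ := by simp [ae_iff]
    filter_upwards [this] with r hr hrs
    rw [Set.uIoc_of_le hs.1] at hrs
    have hlt : r < τ := lt_of_le_of_ne (hrs.2.trans hs.2) hr
    rw [hu (t + r) ⟨by linarith [hrs.1], by linarith⟩]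
  refine ⟨rfl, by simp, fun _ => rfl, hτ, ?_, ?_, ?_⟩
  · exact hc.comp (by fun_prop) hmaps
  · change IntervalIntegrable (fun s => f (π.state (t + s)) u) volume 0 τ
    have h1 : IntervalIntegrable (fun s => f (π.state s) (π.control s)) volume t (t + τ) :=
      (hi' t ⟨ht, by linarith⟩).symm.trans (hi' (t + τ) ⟨by linarith, htτ⟩)
    have h2 := h1.comp_add_left t
    simp only [sub_self, add_sub_cancel_left] at h2
    refine h2.congr_ae ?_
    exact (ae_restrict_iff' measurableSet_uIoc).mpr (hcongr τ ⟨hτ, le_rfl⟩)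
  · intro s hs
    change π.state (t + s) = π.state (t + 0) + ∫ r in (0 : ℝ)..s, f (π.state (t + r)) u
    rw [add_zero, he t ⟨ht, by linarith⟩, he (t + s) (hmaps hs),
      ← intervalIntegral.integral_congr_ae (hcongr s hs),
      intervalIntegral.integral_comp_add_left (fun r => f (π.state r) (π.control r)) t, add_zero,
      add_assoc, intervalIntegral.integral_add_adjacent_intervals (hi' t ⟨ht, by linarith⟩)]
    exact (hi' t ⟨ht, by linarith⟩).symm.trans (hi' (t + s) (hmaps hs))

end

/-! ### Costs of concatenations, and nearest points in state-cost space -/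

section

variable {d D : ℕ}

/-- Concatenation of two trajectories of nonnegative duration with integrable running cost. -/
theorem Traj.concat_cost {g : E d → E D → ℝ} {π ρ : Traj d D}
    (hπ : 0 ≤ π.duration) (hρ : 0 ≤ ρ.duration)
    (iπ : IntervalIntegrable (fun t => g (π.state t) (π.control t)) volume 0 π.duration)
    (iρ : IntervalIntegrable (fun t => g (ρ.state t) (ρ.control t)) volume 0 ρ.duration) :
    IntervalIntegrable (fun t => g ((π.concat ρ).state t) ((π.concat ρ).control t)) volume
        0 (π.concat ρ).duration ∧
      (π.concat ρ).cost g = π.cost g + ρ.cost g := by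
  set a := π.duration with ha
  set b := ρ.duration with hb
  set h : ℝ → ℝ := fun t => g ((π.concat ρ).state t) ((π.concat ρ).control t) with hh
  have e1 : ∀ᵐ t ∂volume, t ∈ Set.uIoc 0 a → g (π.state t) (π.control t) = h t := by
    have : ∀ᵐ t ∂(volume : Measure ℝ), t ≠ a := by simp [ae_iff]
    filter_upwards [this] with t hne ht
    rw [Set.uIoc_of_le hπ] at ht
    have hlt : t < π.duration := lt_of_le_of_ne ht.2 hne
    simp only [hh, Traj.concat, if_pos hlt]
  have e2 : ∀ t ∈ Set.uIoc a (a + b), g (ρ.state (t - a)) (ρ.control (t - a)) = h t := by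
    intro t ht
    rw [Set.uIoc_of_le (by linarith)] at ht
    have hlt : ¬ t < π.duration := not_lt.mpr ht.1.le
    simp only [hh, Traj.concat, if_neg hlt, ha]
  have i1 : IntervalIntegrable h volume 0 a :=
    iπ.congr_ae ((ae_restrict_iff' measurableSet_uIoc).mpr e1)
  have i2 : IntervalIntegrable h volume a (a + b) := by
    have := iρ.comp_sub_right a
    rw [zero_add, add_comm b a] at this
    exact this.congr e2
  refine ⟨i1.trans i2, ?_⟩
  change ∫ t in (0 : ℝ)..(a + b), h t = _
  rw [← intervalIntegral.integral_add_adjacent_intervals i1 i2, Traj.cost, Traj.cost,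
    intervalIntegral.integral_congr_ae e1]
  congr 1
  rw [← intervalIntegral.integral_congr_ae (Filter.Eventually.of_forall e2),
    intervalIntegral.integral_comp_sub_right (fun t => g (ρ.state t) (ρ.control t)), sub_self,
    add_sub_cancel_left]

theorem norm_fst_sub_le_augDist (y z : E d × ℝ) : ‖y.1 - z.1‖ ≤ augDist y z :=
  Real.le_sqrt_of_sq_le (by nlinarith [sq_nonneg |y.2 - z.2|])

theorem abs_snd_sub_le_augDist (y z : E d × ℝ) : |y.2 - z.2| ≤ augDist y z :=
  Real.le_sqrt_of_sq_le (by nlinarith [sq_nonneg ‖y.1 - z.1‖])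

theorem augDist_le_add (y z : E d × ℝ) : augDist y z ≤ ‖y.1 - z.1‖ + |y.2 - z.2| :=
  Real.sqrt_le_iff.mpr ⟨by positivity, by
    nlinarith [mul_nonneg (norm_nonneg (y.1 - z.1)) (abs_nonneg (y.2 - z.2))]⟩

/-- Both coordinates of the points `y` and `z` differ by less than `r`. -/
def CloserThan (r : ℝ) (y z : E d × ℝ) : Prop :=
  ‖y.1 - z.1‖ < r ∧ |y.2 - z.2| < r

/-- Each coordinate of `p - v` is below `2 * r`, so `augDist p v < 4 * r`. The nearer point `w` is
then within `4 * r` of `p` in each coordinate, and `p` is within `r` of `y`. -/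
theorem CloserThan.of_augDist_le {r : ℝ} {p v w y : E d × ℝ} (hv : CloserThan r v y)
    (hp : CloserThan r p y) (hw : augDist p w ≤ augDist p v) : CloserThan (5 * r) w y := by
  have h1 : ‖p.1 - v.1‖ < 2 * r := by
    have := norm_sub_le_norm_sub_add_norm_sub p.1 y.1 v.1
    rw [norm_sub_rev y.1] at this
    linarith [hv.1, hp.1]
  have h2 : |p.2 - v.2| < 2 * r := by
    have := abs_sub_le p.2 y.2 v.2
    rw [abs_sub_comm y.2] at this
    linarith [hv.2, hp.2]
  have h3 := augDist_le_add p v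
  constructor
  · have := norm_sub_le_norm_sub_add_norm_sub w.1 p.1 y.1
    rw [norm_sub_rev w.1 p.1] at this
    linarith [norm_fst_sub_le_augDist p w, hp.1]
  · have := abs_sub_le w.2 p.2 y.2
    rw [abs_sub_comm w.2 p.2] at this
    linarith [abs_snd_sub_le_augDist p w, hp.2]

/-! ### Invariants of the planner -/

namespace Problem

variable (Q : Problem d D)

/-- The vertex obtained by following the trajectory `edge` from the vertex `near`. -/
noncomputable def newVertex (near : Vertex d D) (edge : Traj d D) : Vertex d D :=
  Vertex.child near (edge.state edge.duration, near.point.2 + edge.cost Q.g) edge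

open Classical in
/-- The memory after the vertex `new` has been added to the tree. -/
noncomputable def addVertex (M : Memory d D) (new : Vertex d D) : Memory d D where
  tree := new :: M.tree
  best := if new.point.1 ∈ Q.goal ∧ ((new.point.2 : ℝ) : EReal) < M.bestCost
    then some new else M.best

variable {Q}

/-- Hides the choice of the edge: all later arguments hold for any collision-free propagation, so
uniqueness of solutions plays no role. -/
theorem step_eq_addVertex {M : Memory d D} {s : Sample d D} {near : Vertex d D}
    (hnear : near ∈ M.tree.argmin (fun v => augDist (s.1, s.2.1) v.point))
    (h : ∃ π : Traj d D, π.IsPropagation Q.f near.point.1 s.2.2.2 s.2.2.1 ∧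
        π.CollisionFree Q.F) :
    ∃ edge : Traj d D, edge.IsPropagation Q.f near.point.1 s.2.2.2 s.2.2.1 ∧
      edge.CollisionFree Q.F ∧ Q.step M s = Q.addVertex M (Q.newVertex near edge) := by
  refine ⟨h.choose, h.choose_spec.1, h.choose_spec.2, ?_⟩
  rw [Option.mem_def] at hnear
  simp only [step, hnear, dif_pos h, addVertex, newVertex]
  rfl

theorem step_eq_self_or_addVertex (M : Memory d D) (s : Sample d D) :
    Q.step M s = M ∨ ∃ near ∈ M.tree, ∃ edge : Traj d D,
      edge.IsPropagation Q.f near.point.1 s.2.2.2 s.2.2.1 ∧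
        edge.CollisionFree Q.F ∧ Q.step M s = Q.addVertex M (Q.newVertex near edge) := by
  cases hnear : M.tree.argmin (fun v => augDist (s.1, s.2.1) v.point) with
  | none => left; simp only [step, hnear]
  | some near =>
    by_cases h : ∃ π : Traj d D, π.IsPropagation Q.f near.point.1 s.2.2.2 s.2.2.1 ∧
        π.CollisionFree Q.F
    · exact Or.inr ⟨near, List.argmin_mem hnear, step_eq_addVertex hnear h⟩
    · left; simp only [step, hnear, dif_neg h]

theorem tree_subset_step (M : Memory d D) (s : Sample d D) : M.tree ⊆ (Q.step M s).tree := by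
  rcases step_eq_self_or_addVertex (Q := Q) M s with h | ⟨near, -, edge, -, -, h⟩
  · rw [h]; exact List.Subset.refl _
  · rw [h]; exact List.subset_cons_self _ _

theorem tree_run_mono (s : ℕ → Sample d D) {j k : ℕ} (hjk : j ≤ k) :
    (Q.run s j).tree ⊆ (Q.run s k).tree := by
  induction k, hjk using Nat.le_induction with
  | base => exact List.Subset.refl _
  | succ k _ ih => exact List.Subset.trans ih (tree_subset_step _ _)

/-- If the tree has a vertex close to `y`, the sampled point is close to `y`, and the sampled
motion is feasible near `y`, then a motion that starts near `y` is added to the tree. -/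
theorem exists_newVertex_mem_step {M : Memory d D} {s : Sample d D} {y : E d × ℝ} {r : ℝ}
    (hM : ∃ v ∈ M.tree, CloserThan r v.point y) (hs : CloserThan r (s.1, s.2.1) y)
    (hprop : ∀ x, ‖x - y.1‖ < 5 * r → ∃ ρ : Traj d D,
      ρ.IsPropagation Q.f x s.2.2.2 s.2.2.1 ∧ ρ.CollisionFree Q.F) :
    ∃ near : Vertex d D, CloserThan (5 * r) near.point y ∧ ∃ edge : Traj d D,
      edge.IsPropagation Q.f near.point.1 s.2.2.2 s.2.2.1 ∧ edge.CollisionFree Q.F ∧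
        Q.newVertex near edge ∈ (Q.step M s).tree := by
  obtain ⟨v, hv, hvy⟩ := hM
  cases hnear : M.tree.argmin (fun v => augDist (s.1, s.2.1) v.point) with
  | none =>
    rw [List.argmin_eq_none] at hnear
    simp [hnear] at hv
  | some near =>
    have hle := List.le_of_mem_argmin hv hnear
    have hclose := hvy.of_augDist_le hs hle
    obtain ⟨edge, h1, h2, h3⟩ := step_eq_addVertex hnear (hprop _ hclose.1)
    refine ⟨near, hclose, edge, h1, h2, ?_⟩
    rw [h3]
    exact List.mem_cons_self

/-- The best vertex is at least as good as every vertex of nonzero cost in the goal region;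
this leaves out the root, which the planner never considers as a solution. -/
def BestIsMinimal (Q : Problem d D) (M : Memory d D) : Prop :=
  ∀ v ∈ M.tree, v.point.2 ≠ 0 → v.point.1 ∈ Q.goal → M.bestCost ≤ ((v.point.2 : ℝ) : EReal)

theorem bestCost_addVertex_le (M : Memory d D) (new : Vertex d D) :
    (Q.addVertex M new).bestCost ≤ M.bestCost := by
  by_cases h : new.point.1 ∈ Q.goal ∧ ((new.point.2 : ℝ) : EReal) < M.bestCost
  · have hb : (Q.addVertex M new).best = some new := if_pos h
    rw [Memory.bestCost, hb]
    exact h.2.le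
  · have hb : (Q.addVertex M new).best = M.best := if_neg h
    rw [Memory.bestCost, hb]
    exact le_rfl

theorem BestIsMinimal.addVertex {M : Memory d D} (hM : Q.BestIsMinimal M) (new : Vertex d D) :
    Q.BestIsMinimal (Q.addVertex M new) := by
  intro v hv hv0 hvg
  rcases List.mem_cons.mp hv with rfl | hv
  · by_cases h : ((v.point.2 : ℝ) : EReal) < M.bestCost
    · have : (Q.addVertex M v).best = some v := if_pos ⟨hvg, h⟩
      simp [Memory.bestCost, this]
    · exact (bestCost_addVertex_le M v).trans (not_lt.mp h)
  · exact (bestCost_addVertex_le M new).trans (hM v hv hv0 hvg)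

theorem bestIsMinimal_run (s : ℕ → Sample d D) (k : ℕ) : Q.BestIsMinimal (Q.run s k) := by
  induction k with
  | zero =>
    intro v hv hv0
    rw [List.mem_singleton.mp hv] at hv0
    exact absurd rfl hv0
  | succ k ih =>
    rw [run]
    rcases step_eq_self_or_addVertex (Q := Q) (Q.run s k) (s k) with h | ⟨near, -, edge, -, -, h⟩
    · rwa [h]
    · rw [h]; exact ih.addVertex _

/-- The cost coordinate of a vertex is the cost of the tree path that leads to it. -/
def CostConsistent (Q : Problem d D) (v : Vertex d D) : Prop :=
  0 ≤ v.tracePath.duration ∧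
    IntervalIntegrable (fun t => Q.g (v.tracePath.state t) (v.tracePath.control t)) volume
      0 v.tracePath.duration ∧
    v.tracePath.cost Q.g = v.point.2

/-- Integrability belongs to the invariant because costs add under concatenation only for integrable
integrands. On the new edge it follows from continuity of `Q.g` in the state, which needs `u ∈ Q.U`.
-/
theorem CostConsistent.newVertex {v : Vertex d D} (hv : Q.CostConsistent v) {K : ℝ} (hK : 0 ≤ K)
    (hg : LipschitzInBothWith K Q.X Q.U Q.g) (hFX : Q.F ⊆ Q.X) {x : E d} {u : E D} {t : ℝ}
    (hu : u ∈ Q.U) {edge : Traj d D} (he : edge.IsPropagation Q.f x u t)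
    (hF : edge.CollisionFree Q.F) : Q.CostConsistent (Q.newVertex v edge) := by
  obtain ⟨h1, h2, h3⟩ := hv
  have hi : IntervalIntegrable (fun t => Q.g (edge.state t) (edge.control t)) volume
      0 edge.duration := by
    obtain ⟨-, -, hcu, h0, hc, -⟩ := he
    simp only [hcu]
    exact hg.intervalIntegrable hK hu h0 hc fun t ht => hFX (hF t ht)
  obtain ⟨c1, c2⟩ := Traj.concat_cost h1 he.2.2.2.1 h2 hi
  refine ⟨add_nonneg h1 he.2.2.2.1, c1, ?_⟩
  change (v.tracePath.concat edge).cost Q.g = v.point.2 + edge.cost Q.g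
  rw [c2, h3]

theorem costConsistent_run {K : ℝ} (hK : 0 ≤ K)
    (hg : LipschitzInBothWith K Q.X Q.U Q.g) (hFX : Q.F ⊆ Q.X) {s : ℕ → Sample d D}
    (hs : ∀ i, (s i).2.2.2 ∈ Q.U) (k : ℕ) :
    (∀ v ∈ (Q.run s k).tree, Q.CostConsistent v) ∧
      ∀ v ∈ (Q.run s k).best, Q.CostConsistent v := by
  induction k with
  | zero =>
    refine ⟨fun v hv => ?_, fun v hv => by simp [run, initMemory] at hv⟩
    rw [List.mem_singleton.mp hv]
    refine ⟨le_rfl, IntervalIntegrable.refl, ?_⟩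
    exact intervalIntegral.integral_same
  | succ k ih =>
    rw [run]
    rcases step_eq_self_or_addVertex (Q := Q) (Q.run s k) (s k)
      with h | ⟨near, hnear, edge, he, hF, h⟩
    · rwa [h]
    · rw [h]
      have hnew := (ih.1 near hnear).newVertex hK hg hFX (hs k) he hF
      refine ⟨fun v hv => ?_, fun v hv => ?_⟩
      · rcases List.mem_cons.mp hv with rfl | hv
        exacts [hnew, ih.1 v hv]
      · simp only [addVertex] at hv
        split_ifs at hv
        · rw [← Option.some.inj hv]; exact hnew
        · exact ih.2 v hv

theorem solutionCost_eq_bestCost {K : ℝ} (hK : 0 ≤ K)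
    (hg : LipschitzInBothWith K Q.X Q.U Q.g) (hFX : Q.F ⊆ Q.X) {s : ℕ → Sample d D}
    (hs : ∀ i, (s i).2.2.2 ∈ Q.U) (k : ℕ) :
    Q.solutionCost s k = (Q.run s k).bestCost := by
  have h := (costConsistent_run hK hg hFX hs k).2
  unfold solutionCost solution Memory.bestCost
  cases hb : (Q.run s k).best with
  | none => rfl
  | some v => simp [(h v hb).2.2]

end Problem

end

/-! ### The sampling law and approximate reachability -/

section

variable {d D : ℕ}

namespace Problem

/-- The standing assumptions on a planning instance. -/
structure RegularWith (Q : Problem d D) (K : ℝ) : Prop where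
  isCompact_X : IsCompact Q.X
  F_subset : Q.F ⊆ Q.X
  measurableSet_U : MeasurableSet Q.U
  volume_U_ne_top : volume Q.U ≠ ⊤
  volume_U_inter_ball_pos : ∀ u ∈ Q.U, ∀ r > (0 : ℝ), 0 < volume (Q.U ∩ Metric.ball u r)
  tProp_pos : 0 < Q.tProp
  cMax_pos : 0 < Q.cMax
  K_pos : 0 < K
  lipschitz_f : LipschitzInBothWith K Q.X Q.U Q.f
  lipschitz_g : LipschitzInBothWith K Q.X Q.U Q.g

variable {Q : Problem d D} {K : ℝ}

theorem cond_pos {α : Type*} [MeasurableSpace α] {μ : Measure α} {A B : Set α}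
    (hA : MeasurableSet A) (hAfin : μ A ≠ ⊤) (h : 0 < μ (A ∩ B)) :
    0 < ProbabilityTheory.cond μ A B := by
  rw [ProbabilityTheory.cond_apply hA]
  exact ENNReal.mul_pos (ENNReal.inv_ne_zero.mpr hAfin) h.ne'

theorem RegularWith.sampleLaw_prod_pos (hQ : Q.RegularWith K) {A : Set (E d)} {B C : Set ℝ}
    {G : Set (E D)} (hA : 0 < volume (Q.X ∩ A)) (hB : 0 < volume (Set.Icc 0 Q.cMax ∩ B))
    (hC : 0 < volume (Set.Icc 0 Q.tProp ∩ C)) (hG : 0 < volume (Q.U ∩ G)) :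
    0 < Q.sampleLaw (A ×ˢ B ×ˢ C ×ˢ G) := by
  rw [sampleLaw, Measure.prod_prod, Measure.prod_prod, Measure.prod_prod]
  refine ENNReal.mul_pos ?_ (ENNReal.mul_pos ?_ (ENNReal.mul_pos ?_ ?_).ne').ne'
  · exact (cond_pos hQ.isCompact_X.measurableSet hQ.isCompact_X.measure_ne_top hA).ne'
  · exact (cond_pos measurableSet_Icc isCompact_Icc.measure_ne_top hB).ne'
  · exact (cond_pos measurableSet_Icc isCompact_Icc.measure_ne_top hC).ne'
  · exact (cond_pos hQ.measurableSet_U hQ.volume_U_ne_top hG).ne'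

theorem RegularWith.isProbabilityMeasure_sampleLaw (hQ : Q.RegularWith K)
    (hX : volume Q.X ≠ 0) (hU : volume Q.U ≠ 0) : IsProbabilityMeasure Q.sampleLaw := by
  have h1 := ProbabilityTheory.cond_isProbabilityMeasure_of_finite hX
    hQ.isCompact_X.measure_ne_top
  have h2 := ProbabilityTheory.cond_isProbabilityMeasure_of_finite
    (μ := (volume : Measure ℝ)) (s := Set.Icc 0 Q.cMax)
    (by simpa using hQ.cMax_pos) isCompact_Icc.measure_ne_top
  have h3 := ProbabilityTheory.cond_isProbabilityMeasure_of_finite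
    (μ := (volume : Measure ℝ)) (s := Set.Icc 0 Q.tProp)
    (by simpa using hQ.tProp_pos) isCompact_Icc.measure_ne_top
  have h4 := ProbabilityTheory.cond_isProbabilityMeasure_of_finite hU hQ.volume_U_ne_top
  unfold sampleLaw
  infer_instance

theorem RegularWith.sampleLaw_control_notMem (hQ : Q.RegularWith K) :
    Q.sampleLaw {s | s.2.2.2 ∉ Q.U} = 0 := by
  have : {s : Sample d D | s.2.2.2 ∉ Q.U} = Set.univ ×ˢ Set.univ ×ˢ Set.univ ×ˢ Q.Uᶜ := by
    ext s; simp
  rw [this, sampleLaw, Measure.prod_prod, Measure.prod_prod, Measure.prod_prod,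
    ProbabilityTheory.cond_apply hQ.measurableSet_U, Set.inter_compl_self]
  simp

/-- The centre may be an endpoint of the interval: the start has cost `0`. -/
theorem volume_Icc_inter_ball_pos {c y r : ℝ} (hc : 0 < c) (hy : y ∈ Set.Icc 0 c) (hr : 0 < r) :
    0 < volume (Set.Icc 0 c ∩ Metric.ball y r) := by
  have hlt : max 0 (y - r) < min c (y + r) := by
    rw [max_lt_iff, lt_min_iff, lt_min_iff]
    exact ⟨⟨hc, by linarith [hy.1]⟩, by linarith [hy.2], by linarith⟩
  refine lt_of_lt_of_le ?_ (measure_mono (s := Set.Ioo (max 0 (y - r)) (min c (y + r))) ?_)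
  · simpa using hlt
  · intro t ht
    rw [Real.ball_eq_Ioo]
    exact ⟨⟨(le_max_left _ _).trans ht.1.le, ht.2.le.trans (min_le_left _ _)⟩,
      (le_max_right _ _).trans_lt ht.1, ht.2.trans_le (min_le_right _ _)⟩

/-- The point `y` of the state-cost space can be approximated by tree vertices: for every
accuracy, hitting a suitable list of sample sets in order forces a vertex close to `y`. -/
def Reachable (Q : Problem d D) (y : E d × ℝ) : Prop :=
  ∀ r > (0 : ℝ), ∃ L : List (Set (Sample d D)),
    (∀ G ∈ L, MeasurableSet G ∧ 0 < Q.sampleLaw G) ∧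
      ∀ s k, HitsInOrder s L k → ∃ v ∈ (Q.run s k).tree, CloserThan r v.point y

theorem reachable_start (Q : Problem d D) : Q.Reachable (Q.start, 0) := by
  refine fun r hr => ⟨[], by simp, fun s k _ => ⟨Vertex.root (Q.start, 0), ?_, ?_⟩⟩
  · exact tree_run_mono s (Nat.zero_le k) List.mem_cons_self
  · simp [CloserThan, Vertex.point, hr]

/-- The inductive step along `π`. The required accuracy `r'` dictates a finer accuracy `r` at `y`;
the list for `r` is extended by one set of samples that imitate the piece `q`. The bound on `(M + K)
* τ` keeps every imitating motion within `δ / 2` of its start. -/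
theorem Reachable.propagate (hQ : Q.RegularWith K) {y : E d × ℝ} (hy : Q.Reachable y)
    {u : E D} (hu : u ∈ Q.U) {M δ τ : ℝ} (hM : 0 ≤ M) (hMf : ∀ x ∈ Q.X, ‖Q.f x u‖ ≤ M)
    (hMg : ∀ x ∈ Q.X, ‖Q.g x u‖ ≤ M) (hδ : 0 < δ) (hball : Metric.ball y.1 δ ⊆ Q.F)
    (hcost : y.2 ∈ Set.Icc 0 Q.cMax) (hτ : 0 < τ) (hτprop : τ ≤ Q.tProp) (hKτ : K * τ ≤ 1 / 2)
    (hMτ : (M + K) * τ ≤ δ / 2) {q : Traj d D} (hq : q.IsPropagation Q.f y.1 u τ)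
    (hqF : q.CollisionFree Q.F) : Q.Reachable (q.state τ, y.2 + q.cost Q.g) := by
  intro r' hr'
  have hK := hQ.K_pos
  -- Both the state error `2 * (5 * r) + r + M * r` and the cost error `5 * r + 5 * r + r + M * r`
  -- equal `(11 + M) * r`. The other bounds keep the start within `δ / 2` of `y.1`, the duration
  -- nonnegative, and the speed at most `M + K`.
  obtain ⟨r, hr, hrr', hrδ, hrτ, hr1⟩ : ∃ r > (0 : ℝ), (11 + M) * r ≤ r' ∧ 5 * r ≤ δ / 2 ∧
      r ≤ τ ∧ r ≤ 1 := by
    refine ⟨min (min (r' / (11 + M)) (δ / 10)) (min τ 1), by positivity, ?_, ?_, ?_, ?_⟩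
    · rw [← le_div_iff₀' (by positivity)]
      exact (min_le_left _ _).trans (min_le_left _ _)
    · have := (min_le_left (min (r' / (11 + M)) (δ / 10)) (min τ 1)).trans (min_le_right _ _)
      linarith
    · exact (min_le_right _ _).trans (min_le_left _ _)
    · exact (min_le_right _ _).trans (min_le_right _ _)
  obtain ⟨L, hL, hforce⟩ := hy r hr
  -- Durations lie below `τ`, so that the reference motion `q` exists throughout the sampled one.
  set G : Set (Sample d D) := Metric.ball y.1 r ×ˢ Metric.ball y.2 r ×ˢ Set.Ioc (τ - r) τ ×ˢ
    (Q.U ∩ Metric.ball u r) with hG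
  refine ⟨G :: L, ?_, ?_⟩
  · intro G' hG'
    rcases List.mem_cons.mp hG' with rfl | hG'
    · refine ⟨measurableSet_ball.prod (measurableSet_ball.prod (measurableSet_Ioc.prod
        (hQ.measurableSet_U.inter measurableSet_ball))), hQ.sampleLaw_prod_pos ?_ ?_ ?_ ?_⟩
      · rw [Set.inter_eq_right.mpr]
        · exact Metric.measure_ball_pos _ _ hr
        · exact ((Metric.ball_subset_ball (by linarith)).trans hball).trans hQ.F_subset
      · exact volume_Icc_inter_ball_pos hQ.cMax_pos hcost hr
      · rw [Set.inter_eq_right.mpr]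
        · simpa using hr
        · exact fun t ht => ⟨by linarith [ht.1], ht.2.trans hτprop⟩
      · rw [← Set.inter_assoc, Set.inter_self]
        exact hQ.volume_U_inter_ball_pos u hu r hr
    · exact hL G' hG'
  · rintro s k ⟨j, hjk, hsG, hhit⟩
    obtain ⟨hsx, hsc, hst, hsU, hsu⟩ := hsG
    rw [mem_ball_iff_norm] at hsx hsu
    rw [mem_ball_iff_norm, Real.norm_eq_abs] at hsc
    set σ := (s j).2.2.1
    set w := (s j).2.2.2
    have hσ : 0 ≤ σ := by linarith [hst.1]
    have hprop : ∀ x, ‖x - y.1‖ < 5 * r → ∃ ρ : Traj d D,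
        ρ.IsPropagation Q.f x w σ ∧ ρ.CollisionFree Q.F := by
      intro x hx
      have hsub : Metric.closedBall x (δ / 2) ⊆ Q.F := by
        refine (Metric.closedBall_subset_ball' ?_).trans hball
        rw [dist_eq_norm]; linarith
      refine exists_isPropagation hσ (by positivity) (by positivity) hK.le hsub
        (fun z hz => ?_) (fun z hz z' hz' => ?_)
        ((mul_le_mul_of_nonneg_left hst.2 (by positivity)).trans hMτ)
      · have hzX := hQ.F_subset (hsub hz)
        have h1 := hQ.lipschitz_f z hzX z hzX w hsU u hu
        rw [sub_self, norm_zero, mul_zero, zero_add] at h1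
        have h2 : K * ‖w - u‖ ≤ K * 1 := by gcongr; linarith
        have h3 := norm_le_norm_add_norm_sub' (Q.f z w) (Q.f z u)
        linarith [hMf z hzX]
      · have h1 := hQ.lipschitz_f z (hQ.F_subset (hsub hz)) z' (hQ.F_subset (hsub hz')) w hsU w hsU
        rwa [sub_self w, norm_zero, mul_zero, add_zero] at h1
    obtain ⟨near, hnear, edge, he, heF, hmem⟩ :=
      exists_newVertex_mem_step (M := Q.run s j) (hforce s j hhit) ⟨hsx, hsc⟩ hprop
    refine ⟨_, tree_run_mono s hjk hmem, ?_⟩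
    have heX : ∀ t ∈ Set.Icc 0 σ, edge.state t ∈ Q.X := fun t ht =>
      hQ.F_subset (heF t (by rwa [he.1]))
    have hqX : ∀ t ∈ Set.Icc 0 τ, q.state t ∈ Q.X := fun t ht =>
      hQ.F_subset (hqF t (by rwa [hq.1]))
    have hMr : M * (τ - σ) ≤ M * r := by gcongr; linarith [hst.1]
    have h1 := he.norm_endpoint_sub_le hQ.lipschitz_f hK.le hsU hu heX hq hqX hσ hst.2 hKτ hMf
    have h2 := he.abs_cost_sub_le hQ.lipschitz_f hQ.lipschitz_g hK.le hsU hu heX hq hqX hσ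
      hst.2 hKτ hMg
    constructor
    · change ‖edge.state edge.duration - q.state τ‖ < r'
      rw [he.1]
      linarith [hnear.1]
    · change |near.point.2 + edge.cost Q.g - (y.2 + q.cost Q.g)| < r'
      rw [add_sub_add_comm]
      linarith [hnear.1, hnear.2, abs_add_le (near.point.2 - y.2) (edge.cost Q.g - q.cost Q.g)]

end Problem

/-! ### Following the given trajectory -/

namespace Traj

variable {Q : Problem d D} {K : ℝ} {π : Traj d D}

/-- The cost that has accumulated along `π` at time `t`. -/
noncomputable def costUntil (g : E d → E D → ℝ) (π : Traj d D) (t : ℝ) : ℝ :=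
  ∫ s in (0 : ℝ)..t, g (π.state s) (π.control s)

/-- What is used of a robust trajectory: it is collision-free with clearance `δ`, its running cost
is integrable and its cost is at most `cMax`. -/
structure Trackable (Q : Problem d D) (π : Traj d D) (δ : ℝ) : Prop where
  solves : π.Solves Q.f
  delta_pos : 0 < δ
  ball_subset : ∀ t ∈ Set.Icc 0 π.duration, Metric.ball (π.state t) δ ⊆ Q.F
  intervalIntegrable : ∀ t ∈ Set.Icc 0 π.duration,
    IntervalIntegrable (fun s => Q.g (π.state s) (π.control s)) volume 0 t
  g_nonneg : ∀ t ∈ Set.Icc 0 π.duration, 0 ≤ Q.g (π.state t) (π.control t)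
  cost_le : π.cost Q.g ≤ Q.cMax

variable {δ : ℝ}

/-- As `Q.g` is nonnegative along `π`, the accumulated cost never exceeds the total. Hence every
cost coordinate to be tracked lies in the range of `c_rand`. -/
theorem Trackable.costUntil_mem (hπ : π.Trackable Q δ) {t : ℝ}
    (ht : t ∈ Set.Icc 0 π.duration) : π.costUntil Q.g t ∈ Set.Icc 0 Q.cMax := by
  have hT : π.duration ∈ Set.Icc 0 π.duration := ⟨ht.1.trans ht.2, le_rfl⟩
  constructor
  · exact intervalIntegral.integral_nonneg ht.1 fun s hs => hπ.g_nonneg s ⟨hs.1, hs.2.trans ht.2⟩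
  · have h1 := intervalIntegral.integral_add_adjacent_intervals (hπ.intervalIntegrable t ht)
      ((hπ.intervalIntegrable t ht).symm.trans (hπ.intervalIntegrable _ hT))
    have h2 : 0 ≤ ∫ s in t..π.duration, Q.g (π.state s) (π.control s) :=
      intervalIntegral.integral_nonneg ht.2 fun s hs => hπ.g_nonneg s ⟨ht.1.trans hs.1, hs.2⟩
    have h3 := hπ.cost_le
    unfold cost at h3
    unfold costUntil
    linarith

theorem Trackable.costUntil_add (hπ : π.Trackable Q δ) {t τ : ℝ} {u : E D}
    (ht : 0 ≤ t) (hτ : 0 ≤ τ) (htτ : t + τ ≤ π.duration)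
    (hu : ∀ s ∈ Set.Ico t (t + τ), π.control s = u) :
    π.costUntil Q.g (t + τ) = π.costUntil Q.g t +
      (⟨τ, fun s => π.state (t + s), fun _ => u⟩ : Traj d D).cost Q.g := by
  have i1 := hπ.intervalIntegrable t ⟨ht, by linarith⟩
  have i2 := hπ.intervalIntegrable (t + τ) ⟨by linarith, htτ⟩
  unfold costUntil cost
  rw [← intervalIntegral.integral_add_adjacent_intervals i1 (i1.symm.trans i2)]
  congr 1
  have h := intervalIntegral.integral_comp_add_left (a := 0) (b := τ)
    (fun r => Q.g (π.state r) (π.control r)) t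
  rw [add_zero] at h
  rw [← h]
  refine intervalIntegral.integral_congr_ae ?_
  have : ∀ᵐ r ∂(volume : Measure ℝ), r ≠ τ := by simp [ae_iff]
  filter_upwards [this] with r hr hrs
  rw [Set.uIoc_of_le hτ] at hrs
  have hlt : r < τ := lt_of_le_of_ne hrs.2 hr
  rw [hu (t + r) ⟨by linarith [hrs.1], by linarith⟩]

/-- The point that `π` has reached at time `t` is approximated by tree vertices. -/
def ReachableAt (Q : Problem d D) (π : Traj d D) (t : ℝ) : Prop :=
  Q.Reachable (π.state t, π.costUntil Q.g t)

/-- A stretch of constant control may be too long for one propagation. It is cut into `N` equal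
pieces short enough for `Reachable.propagate`; the admissible length `τ₀` is the same at every point
of the stretch. -/
theorem Trackable.reachableAt_add (hQ : Q.RegularWith K) (hπ : π.Trackable Q δ) {t ℓ : ℝ}
    {u : E D} (huU : u ∈ Q.U) (ht : 0 ≤ t) (hℓ : 0 < ℓ) (htℓ : t + ℓ ≤ π.duration)
    (hu : ∀ s ∈ Set.Ico t (t + ℓ), π.control s = u) (hreach : π.ReachableAt Q t) :
    π.ReachableAt Q (t + ℓ) := by
  have hK := hQ.K_pos
  have hδ := hπ.delta_pos
  -- `Q.U` may be unbounded, so the bounds come from compactness of `Q.X` for this one control.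
  obtain ⟨M₁, hM₁⟩ := hQ.isCompact_X.exists_bound_of_continuousOn
    (hQ.lipschitz_f.continuousOn hK.le huU)
  obtain ⟨M₂, hM₂⟩ := hQ.isCompact_X.exists_bound_of_continuousOn
    (hQ.lipschitz_g.continuousOn hK.le huU)
  set M := max 0 (max M₁ M₂)
  have hM : 0 ≤ M := le_max_left _ _
  have hMf : ∀ x ∈ Q.X, ‖Q.f x u‖ ≤ M := fun x hx =>
    (hM₁ x hx).trans ((le_max_left _ _).trans (le_max_right _ _))
  have hMg : ∀ x ∈ Q.X, ‖Q.g x u‖ ≤ M := fun x hx =>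
    (hM₂ x hx).trans ((le_max_right _ _).trans (le_max_right _ _))
  obtain ⟨τ₀, hτ₀, hτ₀1, hτ₀2, hτ₀3⟩ : ∃ τ₀ > (0 : ℝ), τ₀ ≤ Q.tProp ∧ K * τ₀ ≤ 1 / 2 ∧
      (M + K) * τ₀ ≤ δ / 2 := by
    have := hQ.tProp_pos
    refine ⟨min Q.tProp (min (1 / 2 / K) (δ / 2 / (M + K))), by positivity, min_le_left _ _, ?_, ?_⟩
    · rw [← le_div_iff₀' hK]
      exact (min_le_right _ _).trans (min_le_left _ _)
    · rw [← le_div_iff₀' (by positivity)]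
      exact (min_le_right _ _).trans (min_le_right _ _)
  obtain ⟨N, hN⟩ := exists_nat_gt (ℓ / τ₀)
  have hN0 : (0 : ℝ) < N := lt_of_le_of_lt (by positivity) hN
  set τ := ℓ / N with hτdef
  have hτ : 0 < τ := by positivity
  have hττ₀ : τ ≤ τ₀ := by
    rw [hτdef, div_le_iff₀ hN0]
    rw [div_lt_iff₀ hτ₀] at hN
    linarith
  have hNτ : (N : ℝ) * τ = ℓ := by rw [hτdef]; field_simp
  suffices h : ∀ j : ℕ, j ≤ N → π.ReachableAt Q (t + j * τ) by
    rw [← hNτ]; exact h N le_rfl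
  intro j
  induction j with
  | zero => intro _; simpa using hreach
  | succ j ih =>
    intro hj
    have hle : ((j : ℝ) + 1) * τ ≤ ℓ := by
      rw [← hNτ]
      gcongr
      exact_mod_cast hj
    have hjτ : 0 ≤ (j : ℝ) * τ := by positivity
    have hmem : t + j * τ ∈ Set.Icc 0 π.duration := ⟨by positivity, by linarith⟩
    have hend : t + j * τ + τ ≤ π.duration := by linarith
    have hu' : ∀ s ∈ Set.Ico (t + j * τ) (t + j * τ + τ), π.control s = u := fun s hs =>
      hu s ⟨by linarith [hs.1], by linarith [hs.2]⟩
    have hq := hπ.solves.isPropagation hmem.1 hτ.le hend hu'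
    have hstep := (ih (by omega)).propagate hQ huU hM hMf hMg hδ (hπ.ball_subset _ hmem)
      (hπ.costUntil_mem hmem) hτ (hττ₀.trans hτ₀1)
      ((mul_le_mul_of_nonneg_left hττ₀ hK.le).trans hτ₀2)
      ((mul_le_mul_of_nonneg_left hττ₀ (by positivity)).trans hτ₀3) hq
      (fun s (hs : s ∈ Set.Icc 0 τ) => hπ.ball_subset (t + j * τ + s)
        ⟨add_nonneg hmem.1 hs.1, by linarith [hs.2]⟩ (Metric.mem_ball_self hδ))
    rw [← hπ.costUntil_add hmem.1 hτ.le hend hu'] at hstep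
    have e : t + ((j + 1 : ℕ) : ℝ) * τ = t + j * τ + τ := by push_cast; ring
    rw [ReachableAt, e]
    exact hstep

theorem Trackable.reachableAt_duration (hQ : Q.RegularWith K) (hπ : π.Trackable Q δ)
    (hstart : π.state 0 = Q.start) (hu : π.PiecewiseConstant Q.U) :
    π.ReachableAt Q π.duration := by
  obtain ⟨Δ, hΔ, n, -, hdur, u, huU, hu⟩ := hu
  suffices h : ∀ j : ℕ, j ≤ n → π.ReachableAt Q (j * Δ) by
    rw [hdur]; exact h n le_rfl
  intro j
  induction j with
  | zero =>
    intro _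
    have : π.costUntil Q.g 0 = 0 := intervalIntegral.integral_same
    rw [Nat.cast_zero, zero_mul, ReachableAt, this, hstart]
    exact Q.reachable_start
  | succ j ih =>
    intro hj
    have e : ((j + 1 : ℕ) : ℝ) * Δ = j * Δ + Δ := by push_cast; ring
    rw [e]
    refine hπ.reachableAt_add hQ (huU ⟨j, hj⟩) (by positivity) hΔ ?_ ?_ (ih (by omega))
    · rw [← e, hdur]
      gcongr
    · intro s hs
      refine hu ⟨j, hj⟩ s ⟨hs.1, hs.2.trans_eq ?_⟩
      ring

end Traj

end

/-! ### From reachability of the endpoint to the probability bound -/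

section

variable {d D : ℕ}

theorem Traj.exists_clearance {Q : Problem d D} {π : Traj d D} (h : 0 < π.clearance Q) :
    ∃ δ > (0 : ℝ), (∀ t ∈ Set.Icc 0 π.duration, Metric.ball (π.state t) δ ⊆ Q.F) ∧
      Metric.ball (π.state π.duration) δ ⊆ Q.goal := by
  simp only [Traj.clearance, lt_iSup_iff] at h
  obtain ⟨δ, ⟨hδ, hF, hgoal⟩, -⟩ := h
  exact ⟨δ, hδ, fun t ht => (Set.subset_biUnion_of_mem (u := fun t => Metric.ball (π.state t) δ)
    ht).trans hF, hgoal⟩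

/-- If the end of `π` is approximated by tree vertices, then hitting a suitable list of sample sets
in order forces a solution that costs at most `(1 + ε)` times as much as `π`. -/
theorem Traj.ReachableAt.exists_list_forall_solutionCost_le {Q : Problem d D} {K : ℝ}
    (hQ : Q.RegularWith K) {π : Traj d D} (hreach : π.ReachableAt Q π.duration) {δ ε : ℝ}
    (hδ : 0 < δ) (hgoal : Metric.ball (π.state π.duration) δ ⊆ Q.goal)
    (hε : ε ∈ Set.Ioo (0 : ℝ) 1) (hcpos : 0 < π.cost Q.g) :
    ∃ L : List (Set (Sample d D)), (∀ G ∈ L, MeasurableSet G ∧ 0 < Q.sampleLaw G) ∧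
      ∀ s k, (∀ i, (s i).2.2.2 ∈ Q.U) → HitsInOrder s L k →
        Q.solutionCost s k ≤ (((1 + ε) * π.cost Q.g : ℝ) : EReal) := by
  -- Accuracy `δ` puts the vertex into the goal region; accuracy `ε * π.cost Q.g` controls its cost.
  obtain ⟨L, hL, hforce⟩ := hreach (min δ (ε * π.cost Q.g))
    (lt_min hδ (mul_pos hε.1 hcpos))
  refine ⟨L, hL, fun s k hs hhit => ?_⟩
  obtain ⟨v, hv, hv1, hv2⟩ := hforce s k hhit
  change |v.point.2 - π.cost Q.g| < _ at hv2
  have hv1' := hv1.trans_le (min_le_left _ _)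
  have hv2' := abs_lt.mp (hv2.trans_le (min_le_right _ _))
  -- Here `ε < 1` makes the vertex cost positive, as `BestIsMinimal` requires.
  have hlt : ε * π.cost Q.g < π.cost Q.g := mul_lt_of_lt_one_left hcpos hε.2
  rw [Problem.solutionCost_eq_bestCost hQ.K_pos.le hQ.lipschitz_g hQ.F_subset hs]
  refine (Problem.bestIsMinimal_run s k v hv (by linarith [hv2'.1])
    (hgoal (mem_ball_iff_norm.mpr hv1'))).trans ?_
  exact EReal.coe_le_coe_iff.mpr (by linarith [hv2'.2])

end

end AORRT

theorem theorem1 {d D : ℕ} (Q : AORRT.Problem d D)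
    (hX : IsCompact Q.X)
    (hF : ∃ O : Set (AORRT.E d), IsOpen O ∧ Q.F = Q.X ∩ O)
    (hgoal : Q.goal ⊆ Q.X)
    (hUm : MeasurableSet Q.U) (hUfin : volume Q.U ≠ ⊤)
    (hUpos : ∀ u ∈ Q.U, ∀ r > (0 : ℝ), 0 < volume (Q.U ∩ Metric.ball u r))
    (htProp : 0 < Q.tProp)
    (hgnonneg : ∀ x ∈ Q.X, ∀ u ∈ Q.U, 0 ≤ Q.g x u)
    (hf : AORRT.LipschitzInBoth Q.X Q.U Q.f)
    (hg : AORRT.LipschitzInBoth Q.X Q.U Q.g)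
    (ε : ℝ) (hε : ε ∈ Set.Ioo (0 : ℝ) 1)
    (π : AORRT.Traj d D) (hπ : π.Robust Q) (hπu : π.PiecewiseConstant Q.U)
    (hcpos : 0 < π.cost Q.g) (hcmax : π.cost Q.g ≤ Q.cMax) :
    ∃ k₀ : ℕ, ∃ a > (0 : ℝ), ∃ b > (0 : ℝ),
      ∀ (Ω : Type*) [MeasurableSpace Ω] (P : Measure Ω) [IsProbabilityMeasure P]
        (ξ : ℕ → Ω → AORRT.Sample d D),
        (∀ i, Measurable (ξ i)) → (∀ i, P.map (ξ i) = Q.sampleLaw) →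
        ProbabilityTheory.iIndepFun ξ P →
        ∀ k : ℕ, k₀ < k →
          P.real {ω | (((1 + ε) * π.cost Q.g : ℝ) : EReal) < Q.solutionCost (fun i => ξ i ω) k}
            ≤ a * Real.exp (-b * k) := by
  obtain ⟨⟨hπU, hπs, hπF, hπ0, -⟩, hclear⟩ := hπ
  obtain ⟨δ, hδ, hball, hballgoal⟩ := AORRT.Traj.exists_clearance hclear
  obtain ⟨K₁, hK₁, hf⟩ := hf.exists_with
  obtain ⟨K₂, -, hg⟩ := hg.exists_with
  have hFX : Q.F ⊆ Q.X := by
    obtain ⟨O, -, hO⟩ := hF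
    rw [hO]
    exact Set.inter_subset_left
  have hT : π.duration ∈ Set.Icc 0 π.duration := ⟨hπs.1, le_rfl⟩
  have hQ : Q.RegularWith (max K₁ K₂) :=
    { isCompact_X := hX
      F_subset := hFX
      measurableSet_U := hUm
      volume_U_ne_top := hUfin
      volume_U_inter_ball_pos := hUpos
      tProp_pos := htProp
      cMax_pos := hcpos.trans_le hcmax
      K_pos := lt_max_of_lt_left hK₁
      lipschitz_f := hf _ (le_max_left _ _)
      lipschitz_g := hg _ (le_max_right _ _) }
  -- A non-integrable running cost would have integral `0` by convention, contrary to `hcpos`.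
  have hint : IntervalIntegrable (fun s => Q.g (π.state s) (π.control s)) volume
      0 π.duration := by
    by_contra hcon
    exact hcpos.ne' (intervalIntegral.integral_undef hcon)
  have htrack : π.Trackable Q δ :=
    { solves := hπs
      delta_pos := hδ
      ball_subset := hball
      intervalIntegrable := fun t ht =>
        hint.mono_set (Set.uIcc_subset_uIcc_left (by rwa [Set.uIcc_of_le hπs.1]))
      g_nonneg := fun t ht => hgnonneg _ (hFX (hπF t ht)) _ (hπU t ht)
      cost_le := hcmax }
  obtain ⟨L, hL, hgood⟩ := (htrack.reachableAt_duration hQ hπ0 hπu).exists_list_forall_solutionCost_le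
    hQ hδ hballgoal hε hcpos
  -- `Q.X` contains a ball around the end of `π`, and `Q.U` contains a control of `π`.
  have hlaw : IsProbabilityMeasure Q.sampleLaw := by
    refine hQ.isProbabilityMeasure_sampleLaw ?_ ?_
    · exact ((Metric.measure_ball_pos volume _ hδ).trans_le
        (measure_mono ((hball _ hT).trans hFX))).ne'
    · exact ((hUpos _ (hπU _ hT) 1 one_pos).trans_le (measure_mono Set.inter_subset_left)).ne'
  obtain ⟨a, ha, b, hb, hprob⟩ := AORRT.exists_measureReal_not_hitsInOrder_le L hL
  refine ⟨0, a, ha, b, hb, fun Ω _ P _ ξ hξ hξlaw hind k _ => ?_⟩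
  have hnull : P.real {ω | ∃ i, (ξ i ω).2.2.2 ∉ Q.U} = 0 := by
    rw [measureReal_eq_zero_iff, Set.ofPred_exists, measure_iUnion_null_iff]
    intro i
    have hm : MeasurableSet {s : AORRT.Sample d D | s.2.2.2 ∉ Q.U} :=
      (measurable_snd.comp (measurable_snd.comp measurable_snd)) hUm.compl
    have h := hQ.sampleLaw_control_notMem
    rwa [← hξlaw i, Measure.map_apply (hξ i) hm] at h
  -- Monotonicity and the union bound hold for arbitrary sets, so measurability of the failure event
  -- is not needed.
  have hsub : {ω | (((1 + ε) * π.cost Q.g : ℝ) : EReal) < Q.solutionCost (fun i => ξ i ω) k} ⊆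
      {ω | ¬ AORRT.HitsInOrder (fun i => ξ i ω) L k} ∪ {ω | ∃ i, (ξ i ω).2.2.2 ∉ Q.U} := by
    intro ω hω
    by_contra hcon
    simp only [Set.mem_union, Set.mem_ofPred_eq, not_or, not_not, not_exists] at hcon
    exact absurd hω (not_lt.mpr (hgood _ k hcon.2 hcon.1))
  calc P.real _ ≤ P.real _ := measureReal_mono hsub
    _ ≤ _ := measureReal_union_le _ _
    _ ≤ a * Real.exp (-b * k) := by
      rw [hnull, add_zero]
      exact hprob Ω P ξ hξ hξlaw hind k
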